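/- **Theorem (a priori $L^\infty$ bounds).** Let $d\ge 2$ and let $\Omega\subset\mathbb R^d$ be a bounded Lipschitz domain divided by an interface $\Gamma$ of Lebesgue measure zero into two disjoint open sets $\Omega_1,\Omega_2$, so that $\Omega=\Omega_1\cup\Gamma\cup\Omega_2$. Let $D:\Omega\to\mathbb R^{d\times d}$ be symmetric, constant on each of $\Omega_1$ and $\Omega_2$, and such that $m|\xi|^2\le \xi^TD(x)\xi\le M|\xi|^2$ for all $\xi\in\mathbb R^d$, $x\in\Omega$, with constants $m,M>0$. Let $b:\Omega\times\mathbb R\to\mathbb R$ be a Carathéodory function (measurable in $x$ for every $\xi$, continuous in $\xi$ for a.e. $x$), and let $\alpha\le\beta$ be real constants such that $$b(x,\xi)\ge 0\quad\forall\,\xi\ge\beta,\ \text{a.e. in }\Omega,\qquad b(x,\xi)\le 0\quad\forall\,\xi\le\alpha,\ \text{a.e. in }\Omega.$$ For $g\in L^2(\partial\Omega)$ let $H^1_g(\Omega)$ be the set of functions in $H^1(\Omega)$ whose trace on $\partial\Omega$ is $g$, and let $H^1_0(\Omega)$ be this set for $g=0$. Let $u\in H^1_g(\Omega)$ be any weak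 solution of the semilinear interface problem with Dirichlet data $g$, that is, for every $v\in H^1_0(\Omega)$ the function $b(\cdot,u)\,v$ is integrable on $\Omega$ and $$\int_\Omega D\nabla u\cdot\nabla v\,dx+\int_\Omega b(x,u(x))\,v(x)\,dx=0 .$$ Then $$\min\Big\{\alpha,\ \inf_{\partial\Omega} g\Big\}\ \le\ u(x)\ \le\ \max\Big\{\beta,\ \sup_{\partial\Omega} g\Big\}\qquad\text{for a.e. }x\in\Omega,$$ where $\sup_{\partial\Omega}g$ and $\inf_{\partial\Omega}g$ are the essential supremum and infimum of $g$ with respect to the surface measure on $\partial\Omega$, possibly $+\infty$ or $-\infty$ (in which case the corresponding bound is void). -/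

import Mathlib

open MeasureTheory Filter Topology
open scoped ENNReal NNReal ContDiff Matrix

namespace SemilinearInterface

/-- `ℝ^d` with its Euclidean norm. -/
abbrev E (d : ℕ) : Type := EuclideanSpace ℝ (Fin d)

/-- A (bounded) Lipschitz domain: a nonempty, bounded, connected open set which near each of its
boundary points `z` is the strict epigraph, in the direction of a unit vector `e`, of a Lipschitz
function `γ` of the component of the variable orthogonal to `e`. -/
structure IsLipschitzDomain {d : ℕ} (Ω : Set (E d)) : Prop where
  isOpen : IsOpen Ω
  isConnected : IsConnected Ω
  isBounded : Bornology.IsBounded Ω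
  boundary : ∀ z ∈ frontier Ω, ∃ (e : E d) (γ : E d → ℝ) (L : ℝ≥0) (r : ℝ),
    ‖e‖ = 1 ∧ LipschitzWith L γ ∧ 0 < r ∧
      ∀ y ∈ Metric.ball z r, (y ∈ Ω ↔ γ (y - inner ℝ e y • e) < inner ℝ e y)

/-- The interface `Γ` divides `Ω` into the disjoint open sets `Ω₁` and `Ω₂`; as a hypersurface,
`Γ` has Lebesgue measure zero. -/
structure IsInterfaceDecomposition {d : ℕ} (Ω Ω₁ Ω₂ Γ : Set (E d)) : Prop where
  isOpen_left : IsOpen Ω₁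
  isOpen_right : IsOpen Ω₂
  disjoint : Disjoint Ω₁ Ω₂
  eq_union : Ω = Ω₁ ∪ Γ ∪ Ω₂
  null : volume Γ = 0

/-- The diffusion coefficient: symmetric, constant on each of `Ω₁` and `Ω₂`, and
`m |ξ|² ≤ ξᵀ D(x) ξ ≤ M |ξ|²` for all `ξ` and all `x ∈ Ω`, with `m, M > 0`. -/
structure IsDiffusionCoefficient {d : ℕ} (Ω Ω₁ Ω₂ : Set (E d))
    (D : E d → Matrix (Fin d) (Fin d) ℝ) (m M : ℝ) : Prop where
  symm : ∀ x ∈ Ω, (D x).IsSymm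
  const_left : ∃ D₁ : Matrix (Fin d) (Fin d) ℝ, ∀ x ∈ Ω₁, D x = D₁
  const_right : ∃ D₂ : Matrix (Fin d) (Fin d) ℝ, ∀ x ∈ Ω₂, D x = D₂
  pos_lower : 0 < m
  pos_upper : 0 < M
  lower : ∀ x ∈ Ω, ∀ ξ : E d, m * ‖ξ‖ ^ 2 ≤ ⇑ξ ⬝ᵥ (D x *ᵥ ⇑ξ)
  upper : ∀ x ∈ Ω, ∀ ξ : E d, ⇑ξ ⬝ᵥ (D x *ᵥ ⇑ξ) ≤ M * ‖ξ‖ ^ 2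

/-- `b : Ω × ℝ → ℝ` is a Carathéodory function: Lebesgue measurable in `x ∈ Ω` for every `ξ`,
and continuous in `ξ` for almost every `x ∈ Ω`. -/
structure IsCaratheodory {d : ℕ} (Ω : Set (E d)) (b : E d → ℝ → ℝ) : Prop where
  measurable : ∀ ξ : ℝ, AEMeasurable (fun x => b x ξ) (volume.restrict Ω)
  continuous : ∀ᵐ x ∂(volume.restrict Ω), Continuous (b x)

/-- The barrier-sign conditions with constants `α ≤ β`. -/
structure HasBarrierSigns {d : ℕ} (Ω : Set (E d)) (b : E d → ℝ → ℝ) (α β : ℝ) : Prop where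
  le : α ≤ β
  nonneg : ∀ ξ : ℝ, β ≤ ξ → ∀ᵐ x ∂(volume.restrict Ω), 0 ≤ b x ξ
  nonpos : ∀ ξ : ℝ, ξ ≤ α → ∀ᵐ x ∂(volume.restrict Ω), b x ξ ≤ 0

/-- `u ∈ H¹(Ω)`, with weak gradient `G`. -/
structure MemH1 {d : ℕ} (Ω : Set (E d)) (u : E d → ℝ) (G : E d → E d) : Prop where
  memLp : MemLp u 2 (volume.restrict Ω)
  memLp_grad : MemLp G 2 (volume.restrict Ω)
  weak_grad : ∀ φ : E d → ℝ, ContDiff ℝ ∞ φ → HasCompactSupport φ → tsupport φ ⊆ Ω →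
    ∀ i : Fin d, ∫ x in Ω, u x * gradient φ x i = - ∫ x in Ω, G x i * φ x

/-- Surface measure on `∂Ω` (up to a constant factor): `(d-1)`-dimensional Hausdorff measure. -/
noncomputable def surfaceMeasure {d : ℕ} (Ω : Set (E d)) : Measure (E d) :=
  (Measure.hausdorffMeasure ((d : ℝ) - 1)).restrict (frontier Ω)

/-- `g ∈ L²(∂Ω)` is the trace on `∂Ω` of the function `u ∈ H¹(Ω)` with weak gradient `G`. The trace
operator is the continuous extension to `H¹(Ω)` of the restriction `φ ↦ φ|_∂Ω`, for `φ` smooth up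
to the boundary: `u` is the limit in `H¹(Ω)` of such functions, whose boundary values converge
to `g` in `L²(∂Ω)`. -/
def HasTrace {d : ℕ} (Ω : Set (E d)) (u : E d → ℝ) (G : E d → E d) (g : E d → ℝ) : Prop :=
  MemLp g 2 (surfaceMeasure Ω) ∧
  ∃ φ : ℕ → E d → ℝ, (∀ n, ContDiff ℝ ∞ (φ n)) ∧
    Tendsto (fun n => eLpNorm (fun x => φ n x - u x) 2 (volume.restrict Ω)) atTop (𝓝 0) ∧
    Tendsto (fun n => eLpNorm (fun x => gradient (φ n) x - G x) 2 (volume.restrict Ω))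
      atTop (𝓝 0) ∧
    Tendsto (fun n => eLpNorm (fun x => φ n x - g x) 2 (surfaceMeasure Ω)) atTop (𝓝 0)

/-- `u ∈ H¹_g(Ω)`, with weak gradient `G`: `u ∈ H¹(Ω)` has trace `g` on `∂Ω`. In particular
`H¹_0(Ω)` is the case `g = 0`. -/
def MemH1g {d : ℕ} (Ω : Set (E d)) (g : E d → ℝ) (u : E d → ℝ) (G : E d → E d) : Prop :=
  MemH1 Ω u G ∧ HasTrace Ω u G g

/-- `u ∈ H¹_g(Ω)` is a weak solution: for all `v ∈ H¹_0(Ω)` the pairing `(b(·,u), v)` is defined and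
`∫_Ω D ∇u · ∇v dx + ∫_Ω b(x,u) v dx = 0`. -/
def IsWeakSolution {d : ℕ} (Ω : Set (E d)) (D : E d → Matrix (Fin d) (Fin d) ℝ)
    (b : E d → ℝ → ℝ) (g : E d → ℝ) (u : E d → ℝ) : Prop :=
  ∃ G : E d → E d, MemH1g Ω g u G ∧
    ∀ (v : E d → ℝ) (V : E d → E d), MemH1g Ω (fun _ => 0) v V →
      Integrable (fun x => b x (u x) * v x) (volume.restrict Ω) ∧
      (∫ x in Ω, (D x *ᵥ ⇑(G x)) ⬝ᵥ ⇑(V x)) + ∫ x in Ω, b x (u x) * v x = 0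

/-- `ū = max {β, ess sup_∂Ω g}`, equal to `+∞` if `g` is not essentially bounded above. -/
noncomputable def upperBarrier {d : ℕ} (Ω : Set (E d)) (g : E d → ℝ) (β : ℝ) : EReal :=
  max (β : EReal) (essSup (fun x => (g x : EReal)) (surfaceMeasure Ω))

/-- `u̲ = min {α, ess inf_∂Ω g}`, equal to `-∞` if `g` is not essentially bounded below. -/
noncomputable def lowerBarrier {d : ℕ} (Ω : Set (E d)) (g : E d → ℝ) (α : ℝ) : EReal :=
  min (α : EReal) (essInf (fun x => (g x : EReal)) (surfaceMeasure Ω))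

end SemilinearInterface

namespace SemilinearInterface

/-! Stampacchia truncation. Let `k ≥ β` be a real number bounding `g` a.e. on the boundary. The
function `v = (u - k)⁺` lies in `H¹_0(Ω)`, with gradient `V = 1_{u > k} G`. Testing with `v`, the
reaction term is nonnegative because `b(x, u) ≥ 0` where `u > k`, and the diffusion term equals `∫ D
V · V ≥ m ∫ |V|²`. Their sum is zero, so `V = 0` a.e., hence `v = 0` and `u ≤ k`. The lower bound is
the upper bound for `-u`.

Two facts carry the argument. `MemH1g.posPart_sub` shows that `v` is admissible: since traces are
defined through smooth approximants, the positive part is replaced by the smooth `smoothPos N`,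
composed with the approximants of `u`, and a diagonal choice is made.

`MemH1g.ae_eq_zero` replaces the Poincaré inequality. From `x ∈ Ω`, follow the line parallel to the
first axis up to `∂Ω`. The increment of an approximant is at most the integral of its gradient over
the line, which tends to zero along a subsequence for almost every line. The boundary values also
tend to zero on almost every line, because a surface-null set projects to a null set of lines. -/

/-- Dominated convergence in `L²`, for a limit equal to zero. -/
theorem tendsto_eLpNorm_two_zero_of_dominated {X F : Type*} [MeasurableSpace X]
    [NormedAddCommGroup F] {μ : Measure X} {f : ℕ → X → F} {h : X → ℝ}
    (hf : ∀ n, AEStronglyMeasurable (f n) μ) (hh : MemLp h 2 μ)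
    (hb : ∀ n, ∀ᵐ x ∂μ, ‖f n x‖ ≤ ‖h x‖)
    (hlim : ∀ᵐ x ∂μ, Tendsto (fun n => f n x) atTop (𝓝 0)) :
    Tendsto (fun n => eLpNorm (f n) 2 μ) atTop (𝓝 0) := by
  have h2 : (2 : ℝ≥0∞) ≠ 0 := by simp
  have key : Tendsto (fun n => ∫⁻ x, ‖f n x‖ₑ ^ (2 : ℝ) ∂μ) atTop (𝓝 (∫⁻ _, 0 ∂μ)) := by
    refine tendsto_lintegral_of_dominated_convergence' (fun x => ‖h x‖ₑ ^ (2 : ℝ))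
      (fun n => (hf n).enorm.pow_const _) ?_ ?_ ?_
    · intro n
      filter_upwards [hb n] with x hx
      gcongr
      exact enorm_le_iff_norm_le.2 hx
    · have := hh.eLpNorm_lt_top
      rw [eLpNorm_eq_lintegral_rpow_enorm_toReal h2 (by simp)] at this
      have := ENNReal.rpow_lt_top_iff_of_pos (by norm_num) |>.1 this
      simpa using this.ne
    · filter_upwards [hlim] with x hx
      have := (ENNReal.continuous_rpow_const (y := (2 : ℝ))).tendsto 0 |>.comp
        (by simpa using hx.enorm)
      simpa [Function.comp_def] using this
  have := ((ENNReal.continuous_rpow_const (y := (1 / 2 : ℝ))).tendsto 0).comp (by simpa using key)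
  simpa [Function.comp_def, eLpNorm_eq_lintegral_rpow_enorm_toReal h2] using this

/-! ### Smooth approximation of the positive part -/

/-- A smooth approximation of the positive part of a real number. -/
noncomputable def smoothPos (N : ℕ) (t : ℝ) : ℝ := t * expNegInvGlue (N * t)

theorem smoothPos_of_nonpos (N : ℕ) {t : ℝ} (ht : t ≤ 0) : smoothPos N t = 0 := by
  rw [smoothPos, expNegInvGlue.zero_of_nonpos, mul_zero]
  exact mul_nonpos_of_nonneg_of_nonpos N.cast_nonneg ht

theorem expNegInvGlue_of_pos {t : ℝ} (ht : 0 < t) : expNegInvGlue t = Real.exp (-t⁻¹) := by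
  simp [expNegInvGlue, ht.not_ge]

theorem expNegInvGlue_le_one (t : ℝ) : expNegInvGlue t ≤ 1 := by
  rcases le_or_gt t 0 with h | h
  · simp [expNegInvGlue.zero_of_nonpos h]
  · rw [expNegInvGlue_of_pos h, Real.exp_le_one_iff]
    simpa using h.le

theorem smoothPos_nonneg (N : ℕ) (t : ℝ) : 0 ≤ smoothPos N t := by
  rcases le_or_gt t 0 with h | h
  · rw [smoothPos_of_nonpos N h]
  · exact mul_nonneg h.le (expNegInvGlue.nonneg _)

theorem smoothPos_le (N : ℕ) (t : ℝ) : smoothPos N t ≤ max t 0 := by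
  rcases le_or_gt t 0 with h | h
  · rw [smoothPos_of_nonpos N h]; exact le_max_right _ _
  · refine le_trans ?_ (le_max_left _ _)
    exact mul_le_of_le_one_right h.le (expNegInvGlue_le_one _)

theorem contDiff_smoothPos (N : ℕ) : ContDiff ℝ ∞ (smoothPos N) :=
  contDiff_id.mul (expNegInvGlue.contDiff.comp (contDiff_const.mul contDiff_id))

/-- Every such `t` is a global minimum, which also settles the gluing point `t = 0`. -/
theorem deriv_smoothPos_of_nonpos (N : ℕ) {t : ℝ} (ht : t ≤ 0) : deriv (smoothPos N) t = 0 := by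
  apply IsLocalMin.deriv_eq_zero
  filter_upwards with s
  rw [smoothPos_of_nonpos N ht]
  exact smoothPos_nonneg N s

theorem deriv_smoothPos_of_pos {N : ℕ} (hN : 0 < N) {t : ℝ} (ht : 0 < t) :
    deriv (smoothPos N) t = Real.exp (-(N * t)⁻¹) * (1 + (N * t)⁻¹) := by
  have hN' : (0 : ℝ) < N := by exact_mod_cast hN
  have h : HasDerivAt (fun s : ℝ => s * Real.exp (-(N * s)⁻¹))
      (Real.exp (-(N * t)⁻¹) * (1 + (N * t)⁻¹)) t := by
    have h1 : HasDerivAt (fun s : ℝ => (N : ℝ) * s) N t := by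
      simpa using (hasDerivAt_id t).const_mul (N : ℝ)
    have h2 := (hasDerivAt_id t).mul (h1.inv (by positivity)).neg.exp
    refine h2.congr_deriv ?_
    simp only [id, Pi.neg_apply, Pi.inv_apply]
    field_simp
  refine HasDerivAt.deriv (h.congr_of_eventuallyEq ?_)
  filter_upwards [lt_mem_nhds ht] with s hs
  rw [smoothPos, expNegInvGlue_of_pos (by positivity)]

/-- With `s = 1/(N t)` this is `1 + s ≤ exp s`. Uniformity in `N` provides the dominating functions
below. -/
theorem abs_deriv_smoothPos_le {N : ℕ} (hN : 0 < N) (t : ℝ) : |deriv (smoothPos N) t| ≤ 1 := by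
  rcases le_or_gt t 0 with h | h
  · simp [deriv_smoothPos_of_nonpos N h]
  · have hN' : (0 : ℝ) < N := by exact_mod_cast hN
    rw [deriv_smoothPos_of_pos hN h, abs_of_nonneg (by positivity), Real.exp_neg,
      inv_mul_le_one₀ (Real.exp_pos _), add_comm]
    exact Real.add_one_le_exp _

theorem abs_smoothPos_sub_le {N : ℕ} (hN : 0 < N) (s t : ℝ) :
    |smoothPos N s - smoothPos N t| ≤ |s - t| := by
  have := Convex.norm_image_sub_le_of_norm_deriv_le (f := smoothPos N) (C := 1) (s := Set.univ)
    (x := t) (y := s)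
    (fun x _ => ((contDiff_smoothPos N).differentiable (by simp)).differentiableAt)
    (fun x _ => abs_deriv_smoothPos_le hN x) convex_univ trivial trivial
  simpa using this

theorem tendsto_inv_natCast_mul {t : ℝ} (ht : 0 < t) :
    Tendsto (fun N : ℕ => ((N : ℝ) * t)⁻¹) atTop (𝓝 0) :=
  (tendsto_natCast_atTop_atTop.atTop_mul_const ht).inv_tendsto_atTop

theorem tendsto_smoothPos (t : ℝ) :
    Tendsto (fun N => smoothPos N t) atTop (𝓝 (max t 0)) := by
  rcases le_or_gt t 0 with h | h
  · simp [smoothPos_of_nonpos _ h, h]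
  · have h1 : Tendsto (fun N : ℕ => t * Real.exp (-(N * t)⁻¹)) atTop (𝓝 (t * Real.exp (-0))) :=
      ((Real.continuous_exp.tendsto _).comp (tendsto_inv_natCast_mul h).neg).const_mul t
    rw [max_eq_left h.le]
    simp only [neg_zero, Real.exp_zero, mul_one] at h1
    refine h1.congr' ?_
    filter_upwards [eventually_gt_atTop 0] with N hN
    have hN' : (0 : ℝ) < N := by exact_mod_cast hN
    rw [smoothPos, expNegInvGlue_of_pos (by positivity)]

theorem tendsto_deriv_smoothPos (t : ℝ) :
    Tendsto (fun N => deriv (smoothPos N) t) atTop (𝓝 (if 0 < t then 1 else 0)) := by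
  rcases le_or_gt t 0 with h | h
  · simp [deriv_smoothPos_of_nonpos _ h, h.not_gt]
  · have h0 := tendsto_inv_natCast_mul h
    have h1 : Tendsto (fun N : ℕ => Real.exp (-(N * t)⁻¹) * (1 + (N * t)⁻¹)) atTop
        (𝓝 (Real.exp (-0) * (1 + 0))) :=
      ((Real.continuous_exp.tendsto _).comp h0.neg).mul (h0.const_add 1)
    simp only [neg_zero, Real.exp_zero, mul_one, add_zero] at h1
    rw [if_pos h]
    refine h1.congr' ?_
    filter_upwards [eventually_gt_atTop 0] with N hN
    rw [deriv_smoothPos_of_pos hN h]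

/-! ### Gradients of smooth functions -/

section Gradient

variable {d : ℕ}

theorem continuous_gradient {φ : E d → ℝ} (h : ContDiff ℝ ∞ φ) : Continuous (gradient φ) :=
  (InnerProductSpace.toDual ℝ (E d)).symm.continuous.comp (h.continuous_fderiv (by simp))

theorem gradient_apply (φ : E d → ℝ) (x : E d) (i : Fin d) :
    gradient φ x i = fderiv ℝ φ x (EuclideanSpace.single i 1) := by
  rw [← inner_gradient_left, EuclideanSpace.inner_single_right]
  simp

theorem gradient_comp_sub_const {φ : E d → ℝ} (hφ : ContDiff ℝ ∞ φ) {ψ : ℝ → ℝ}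
    (hψ : ContDiff ℝ ∞ ψ) (k : ℝ) (x : E d) :
    gradient (fun y => ψ (φ y - k)) x = deriv ψ (φ x - k) • gradient φ x := by
  have h1 : HasFDerivAt φ (fderiv ℝ φ x) x := (hφ.differentiable (by simp) x).hasFDerivAt
  have h2 : HasDerivAt ψ (deriv ψ (φ x - k)) (φ x - k) :=
    (hψ.differentiable (by simp) _).hasDerivAt
  have h3 := h2.comp_hasFDerivAt x (h1.sub_const k)
  ext i
  rw [gradient_apply, PiLp.smul_apply, gradient_apply]
  have : fderiv ℝ (fun y => ψ (φ y - k)) x = deriv ψ (φ x - k) • fderiv ℝ φ x := h3.fderiv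
  rw [this]
  rfl

end Gradient

/-! ### Closedness of `H¹` under limits of smooth functions -/

section

/-- Strong `L²` convergence implies weak convergence. -/
theorem tendsto_integral_mul_of_tendsto_eLpNorm_two {X : Type*} [MeasurableSpace X]
    {μ : Measure X} {f : ℕ → X → ℝ} {g a : X → ℝ} (ha : MemLp a 2 μ) (hg : MemLp g 2 μ)
    (hf : ∀ n, AEStronglyMeasurable (f n) μ) (hfa : ∀ n, Integrable (fun x => f n x * a x) μ)
    (h : Tendsto (fun n => eLpNorm (fun x => f n x - g x) 2 μ) atTop (𝓝 0)) :
    Tendsto (fun n => ∫ x, f n x * a x ∂μ) atTop (𝓝 (∫ x, g x * a x ∂μ)) := by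
  have hga : Integrable (fun x => g x * a x) μ := hg.integrable_mul ha
  refine tendsto_integral_of_L1' _ hga.1 (Eventually.of_forall hfa) ?_
  have h1 : Tendsto (fun n => eLpNorm (fun x => f n x - g x) 2 μ * eLpNorm a 2 μ) atTop (𝓝 0) := by
    simpa using ENNReal.Tendsto.mul_const h (Or.inr ha.eLpNorm_ne_top)
  refine tendsto_of_tendsto_of_tendsto_of_le_of_le tendsto_const_nhds h1 (fun _ => zero_le) ?_
  intro n
  have := eLpNorm_le_eLpNorm_mul_eLpNorm_of_nnnorm (p := 2) (q := 2) (r := 1)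
    ((hf n).fun_sub hg.1) ha.1 (fun s t => s * t) 1
    (Eventually.of_forall fun x => by simp)
  have h' : ((fun x => f n x * a x) - fun x => g x * a x) = fun x => (f n x - g x) * a x := by
    ext x
    simp [sub_mul]
  beta_reduce
  rw [h']
  simpa using this

variable {d : ℕ}

/-- Since `η` and its gradient vanish off `Ω`, both integrals extend to the whole space, where there
is no boundary term. -/
theorem setIntegral_mul_gradient {Ω : Set (E d)} {f η : E d → ℝ} (hf : ContDiff ℝ ∞ f)
    (hη : ContDiff ℝ ∞ η) (hc : HasCompactSupport η) (hs : tsupport η ⊆ Ω) (i : Fin d) :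
    ∫ x in Ω, f x * gradient η x i = - ∫ x in Ω, gradient f x i * η x := by
  have hcg : HasCompactSupport (fun x => gradient η x i) := by
    simp only [gradient_apply]
    exact hc.fderiv_apply ℝ _
  have hci : ∀ {φ : E d → ℝ}, ContDiff ℝ ∞ φ → Continuous fun x => gradient φ x i := fun h =>
    (EuclideanSpace.proj (𝕜 := ℝ) i).continuous.comp (continuous_gradient h)
  have h0 : ∀ x, x ∉ Ω → η x = 0 := fun x hx => image_eq_zero_of_notMem_tsupport fun h => hx (hs h)
  have h0' : ∀ x, x ∉ Ω → gradient η x i = 0 := fun x hx => by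
    rw [gradient_apply, fderiv_of_notMem_tsupport ℝ fun h => hx (hs h)]; rfl
  rw [setIntegral_eq_integral_of_forall_compl_eq_zero fun x hx => by rw [h0' x hx, mul_zero],
    setIntegral_eq_integral_of_forall_compl_eq_zero fun x hx => by rw [h0 x hx, mul_zero]]
  have := integral_mul_fderiv_eq_neg_fderiv_mul_of_integrable (μ := (volume : Measure (E d)))
    (f := f) (g := η) (v := EuclideanSpace.single i 1)
    (by
      simp only [← gradient_apply]
      exact ((hci hf).mul hη.continuous).integrable_of_hasCompactSupport hc.mul_left)
    (by
      simp only [← gradient_apply]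
      exact (hf.continuous.mul (hci hη)).integrable_of_hasCompactSupport hcg.mul_left)
    ((hf.continuous.mul hη.continuous).integrable_of_hasCompactSupport hc.mul_left)
    (fun x _ => hf.differentiable (by simp) x) (fun x _ => hη.differentiable (by simp) x)
  simpa only [← gradient_apply] using this

/-- An `L²` limit of smooth functions, whose gradients converge in `L²`, belongs to `H¹`. -/
theorem MemH1.of_tendsto {Ω : Set (E d)} {v : E d → ℝ} {V : E d → E d}
    (hv : MemLp v 2 (volume.restrict Ω)) (hV : MemLp V 2 (volume.restrict Ω))
    {φ : ℕ → E d → ℝ} (hφ : ∀ n, ContDiff ℝ ∞ (φ n))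
    (h1 : Tendsto (fun n => eLpNorm (fun x => φ n x - v x) 2 (volume.restrict Ω)) atTop (𝓝 0))
    (h2 : Tendsto (fun n => eLpNorm (fun x => gradient (φ n) x - V x) 2 (volume.restrict Ω))
      atTop (𝓝 0)) : MemH1 Ω v V := by
  refine ⟨hv, hV, fun η hη hc hs i => ?_⟩
  have hci : ∀ {φ : E d → ℝ}, ContDiff ℝ ∞ φ → Continuous fun x => gradient φ x i := fun h =>
    (EuclideanSpace.proj (𝕜 := ℝ) i).continuous.comp (continuous_gradient h)
  have hcg : HasCompactSupport (fun x => gradient η x i) := by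
    simp only [gradient_apply]
    exact hc.fderiv_apply ℝ _
  have hcomp : ∀ (W : E d → E d), ∀ x, ‖W x i‖ ≤ ‖W x‖ := fun W x => PiLp.norm_apply_le _ _
  have hVi : MemLp (fun x => V x i) 2 (volume.restrict Ω) :=
    hV.continuousLinearMap_comp (EuclideanSpace.proj (𝕜 := ℝ) i)
  have h2' : Tendsto (fun n => eLpNorm (fun x => gradient (φ n) x i - V x i) 2
      (volume.restrict Ω)) atTop (𝓝 0) :=
    tendsto_of_tendsto_of_tendsto_of_le_of_le tendsto_const_nhds h2 (fun _ => zero_le) fun n =>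
      eLpNorm_mono fun x => hcomp (fun x => gradient (φ n) x - V x) x
  have L1 := tendsto_integral_mul_of_tendsto_eLpNorm_two
    (((hci hη).memLp_of_hasCompactSupport hcg).restrict Ω) hv
    (fun n => (hφ n).continuous.aestronglyMeasurable)
    (fun n => ((((hφ n).continuous.mul (hci hη)).integrable_of_hasCompactSupport
      hcg.mul_left).restrict)) h1
  have L2 := tendsto_integral_mul_of_tendsto_eLpNorm_two
    ((hη.continuous.memLp_of_hasCompactSupport hc).restrict Ω) hVi
    (fun n => (hci (hφ n)).aestronglyMeasurable)
    (fun n => ((((hci (hφ n)).mul hη.continuous).integrable_of_hasCompactSupport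
      hc.mul_left).restrict)) h2'
  refine tendsto_nhds_unique L1 (L2.neg.congr fun n => ?_)
  exact (setIntegral_mul_gradient (hφ n) hη hc hs i).symm

end

/-! ### Truncation in `H¹` and its trace -/

section

variable {d : ℕ}

theorem tendsto_ae_subseq_of_tendsto_eLpNorm_two {X : Type*} [MeasurableSpace X]
    {μ : Measure X} {f : ℕ → X → ℝ} {g : X → ℝ} (hf : ∀ n, AEStronglyMeasurable (f n) μ)
    (hg : AEStronglyMeasurable g μ)
    (h : Tendsto (fun n => eLpNorm (fun x => f n x - g x) 2 μ) atTop (𝓝 0)) :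
    ∃ ns : ℕ → ℕ, StrictMono ns ∧
      ∀ᵐ x ∂μ, Tendsto (fun n => f (ns n) x) atTop (𝓝 (g x)) :=
  (tendstoInMeasure_of_tendsto_eLpNorm (by simp) hf hg h).exists_seq_tendsto_ae

theorem eLpNorm_two_sub_lt {X F : Type*} [MeasurableSpace X] [NormedAddCommGroup F]
    {μ : Measure X} {a b c : X → F} (ha : AEStronglyMeasurable a μ)
    (hb : AEStronglyMeasurable b μ) (hc : AEStronglyMeasurable c μ) {ε : ℝ≥0∞}
    (h1 : eLpNorm (fun x => a x - b x) 2 μ < ε / 2)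
    (h2 : eLpNorm (fun x => b x - c x) 2 μ < ε / 2) :
    eLpNorm (fun x => a x - c x) 2 μ < ε := by
  have h := eLpNorm_add_le (ha.fun_sub hb) (hb.fun_sub hc) (p := 2) (by norm_num)
  have h' : (fun x => a x - c x) = (fun x => a x - b x) + fun x => b x - c x := by
    ext x; simp
  rw [h']
  exact h.trans_lt ((ENNReal.add_lt_add h1 h2).trans_eq (ENNReal.add_halves ε))

theorem MemH1.memLp_posPart {Ω : Set (E d)} [IsFiniteMeasure (volume.restrict Ω)]
    {u : E d → ℝ} {G : E d → E d} (h : MemH1 Ω u G) (k : ℝ) :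
    MemLp (fun x => max (u x - k) 0) 2 (volume.restrict Ω) ∧
      MemLp (fun x => (if 0 < u x - k then (1 : ℝ) else 0) • G x) 2 (volume.restrict Ω) := by
  have h1 : MemLp (fun x => u x - k) 2 (volume.restrict Ω) := h.memLp.sub (memLp_const k)
  refine ⟨h1.pos_part, ?_⟩
  have hm : Measurable fun t : ℝ => if 0 < t then (1 : ℝ) else 0 :=
    Measurable.ite measurableSet_Ioi measurable_const measurable_const
  refine h.memLp_grad.of_le ?_ (Eventually.of_forall fun x => ?_)
  · exact (hm.comp_aemeasurable h1.1.aemeasurable).aestronglyMeasurable.smul h.memLp_grad.1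
  · rw [norm_smul]
    refine mul_le_of_le_one_left (norm_nonneg _) ?_
    split_ifs <;> simp

/-- The composition of the approximants of `u` with a smooth approximation of the positive part
converges in `H¹`. -/
theorem tendsto_smoothPos_comp {Ω : Set (E d)} {u : E d → ℝ} {G : E d → E d} (h : MemH1 Ω u G)
    {φ : ℕ → E d → ℝ} (hφ : ∀ n, ContDiff ℝ ∞ (φ n)) (k : ℝ) {N : ℕ} (hN : 0 < N)
    (hu : Tendsto (fun n => eLpNorm (fun x => φ n x - u x) 2 (volume.restrict Ω)) atTop (𝓝 0))
    (hae : ∀ᵐ x ∂(volume.restrict Ω), Tendsto (fun n => φ n x) atTop (𝓝 (u x)))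
    (hG : Tendsto (fun n => eLpNorm (fun x => gradient (φ n) x - G x) 2 (volume.restrict Ω))
      atTop (𝓝 0)) :
    Tendsto (fun n => eLpNorm (fun x => smoothPos N (φ n x - k) - smoothPos N (u x - k)) 2
        (volume.restrict Ω)) atTop (𝓝 0) ∧
      Tendsto (fun n => eLpNorm (fun x => gradient (fun y => smoothPos N (φ n y - k)) x -
        deriv (smoothPos N) (u x - k) • G x) 2 (volume.restrict Ω)) atTop (𝓝 0) := by
  have hc : Continuous (deriv (smoothPos N)) := (contDiff_smoothPos N).continuous_deriv (by simp)
  constructor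
  · refine tendsto_of_tendsto_of_tendsto_of_le_of_le tendsto_const_nhds hu (fun _ => zero_le)
      fun n => eLpNorm_mono fun x => ?_
    simpa using abs_smoothPos_sub_le hN (φ n x - k) (u x - k)
  · have hm : ∀ n, AEStronglyMeasurable (fun x => deriv (smoothPos N) (φ n x - k))
        (volume.restrict Ω) := fun n =>
      (hc.comp ((hφ n).continuous.sub continuous_const)).aestronglyMeasurable
    have hmu : AEStronglyMeasurable (fun x => deriv (smoothPos N) (u x - k))
        (volume.restrict Ω) :=
      hc.comp_aestronglyMeasurable (h.memLp.1.sub aestronglyMeasurable_const)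
    have hmG : ∀ n, AEStronglyMeasurable (fun x => gradient (φ n) x - G x)
        (volume.restrict Ω) := fun n =>
      (continuous_gradient (hφ n)).aestronglyMeasurable.sub h.memLp_grad.1
    -- With `ψ = smoothPos N`, the error is `ψ'(φₙ - k) (∇φₙ - G) + (ψ'(φₙ - k) - ψ'(u - k)) G`. The
    -- first term is controlled by `|ψ'| ≤ 1`, the second by dominated convergence.
    have T1 : Tendsto (fun n => eLpNorm (fun x => deriv (smoothPos N) (φ n x - k) •
        (gradient (φ n) x - G x)) 2 (volume.restrict Ω)) atTop (𝓝 0) := by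
      refine tendsto_of_tendsto_of_tendsto_of_le_of_le tendsto_const_nhds hG (fun _ => zero_le)
        fun n => eLpNorm_mono fun x => ?_
      rw [norm_smul]
      exact mul_le_of_le_one_left (norm_nonneg _) (abs_deriv_smoothPos_le hN _)
    have T2 : Tendsto (fun n => eLpNorm (fun x => (deriv (smoothPos N) (φ n x - k) -
        deriv (smoothPos N) (u x - k)) • G x) 2 (volume.restrict Ω)) atTop (𝓝 0) := by
      refine tendsto_eLpNorm_two_zero_of_dominated (h := fun x => 2 * ‖G x‖)
        (fun n => ((hm n).sub hmu).smul h.memLp_grad.1) (h.memLp_grad.norm.const_mul 2)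
        (fun n => Eventually.of_forall fun x => ?_) ?_
      · have h1 := abs_deriv_smoothPos_le hN (φ n x - k)
        have h2 := abs_deriv_smoothPos_le hN (u x - k)
        rw [norm_smul, norm_mul, norm_norm, Real.norm_ofNat, Real.norm_eq_abs]
        gcongr
        exact (abs_sub _ _).trans (by linarith)
      · filter_upwards [hae] with x hx
        have h1 := (hc.tendsto (u x - k)).comp (hx.sub_const k)
        simpa using (h1.sub_const (deriv (smoothPos N) (u x - k))).smul_const (G x)
    have T := T1.add T2
    rw [add_zero] at T
    refine tendsto_of_tendsto_of_tendsto_of_le_of_le tendsto_const_nhds T (fun _ => zero_le)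
      fun n => ?_
    refine le_trans (le_of_eq ?_) (eLpNorm_add_le ((hm n).smul (hmG n))
      (((hm n).sub hmu).smul h.memLp_grad.1) (by norm_num))
    congr 1
    ext1 x
    simp only [gradient_comp_sub_const (hφ n) (contDiff_smoothPos N), Pi.add_apply]
    module

/-- The smooth approximations of the positive part of `u - k` converge in `H¹`. -/
theorem tendsto_smoothPos_sub {Ω : Set (E d)} [IsFiniteMeasure (volume.restrict Ω)]
    {u : E d → ℝ} {G : E d → E d} (h : MemH1 Ω u G) (k : ℝ) :
    Tendsto (fun N => eLpNorm (fun x => smoothPos N (u x - k) - max (u x - k) 0) 2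
        (volume.restrict Ω)) atTop (𝓝 0) ∧
      Tendsto (fun N => eLpNorm (fun x => deriv (smoothPos N) (u x - k) • G x -
        (if 0 < u x - k then (1 : ℝ) else 0) • G x) 2 (volume.restrict Ω)) atTop (𝓝 0) := by
  have hk : MemLp (fun x => u x - k) 2 (volume.restrict Ω) := h.memLp.sub (memLp_const k)
  obtain ⟨hv, hV⟩ := h.memLp_posPart k
  constructor
  · refine tendsto_eLpNorm_two_zero_of_dominated (h := fun x => u x - k)
      (fun N => ((contDiff_smoothPos N).continuous.comp_aestronglyMeasurable hk.1).sub hv.1) hk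
      (fun N => Eventually.of_forall fun x => ?_) (Eventually.of_forall fun x => ?_)
    · rw [Real.norm_eq_abs, Real.norm_eq_abs, abs_le]
      have h1 := smoothPos_nonneg N (u x - k)
      have h2 := smoothPos_le N (u x - k)
      have h3 : max (u x - k) 0 ≤ |u x - k| := max_le (le_abs_self _) (abs_nonneg _)
      constructor <;> linarith [abs_nonneg (u x - k)]
    · simpa using (tendsto_smoothPos (u x - k)).sub_const (max (u x - k) 0)
  -- The shift skips `N = 0`, which the derivative bound does not cover.
  · rw [← tendsto_add_atTop_iff_nat 1]
    refine tendsto_eLpNorm_two_zero_of_dominated (h := fun x => 2 * ‖G x‖) (fun N => ?_)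
      (h.memLp_grad.norm.const_mul 2)
      (fun N => Eventually.of_forall fun x => ?_) (Eventually.of_forall fun x => ?_)
    · exact ((((contDiff_smoothPos _).continuous_deriv (by simp)).comp_aestronglyMeasurable
        hk.1).smul h.memLp_grad.1).sub hV.1
    · rw [← sub_smul, norm_smul, norm_mul, norm_norm, Real.norm_ofNat, Real.norm_eq_abs]
      gcongr
      refine (abs_sub _ _).trans ?_
      have h1 := abs_deriv_smoothPos_le N.succ_pos (u x - k)
      have h2 : |if 0 < u x - k then (1 : ℝ) else 0| ≤ 1 := by split_ifs <;> simp
      exact (add_le_add h1 h2).trans (by norm_num)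
    · have := (((tendsto_deriv_smoothPos (u x - k)).comp (tendsto_add_atTop_nat 1)).smul_const
        (G x)).sub_const ((if 0 < u x - k then (1 : ℝ) else 0) • G x)
      rw [sub_self] at this
      exact this

/-- If `u ∈ H¹_g(Ω)` and `g ≤ k` on `∂Ω`, then `(u - k)⁺ ∈ H¹_0(Ω)`. -/
theorem MemH1g.posPart_sub {Ω : Set (E d)} [IsFiniteMeasure (volume.restrict Ω)]
    {g u : E d → ℝ} {G : E d → E d} (h : MemH1g Ω g u G) {k : ℝ}
    (hgk : ∀ᵐ x ∂(surfaceMeasure Ω), g x ≤ k) :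
    MemH1g Ω (fun _ => 0) (fun x => max (u x - k) 0)
      (fun x => (if 0 < u x - k then (1 : ℝ) else 0) • G x) := by
  obtain ⟨h, -, φ₀, hφ₀, hu₀, hG₀, hg₀⟩ := h
  obtain ⟨ns, hns, hae⟩ := tendsto_ae_subseq_of_tendsto_eLpNorm_two
    (fun n => (hφ₀ n).continuous.aestronglyMeasurable) h.memLp.1 hu₀
  obtain ⟨hv, hV⟩ := h.memLp_posPart k
  have hk : MemLp (fun x => u x - k) 2 (volume.restrict Ω) := h.memLp.sub (memLp_const k)
  -- Diagonal choice: `N` is fixed first, then an approximant of `u` depending on `N`.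
  have key : ∀ ε : ℝ≥0∞, 0 < ε → ∃ χ : E d → ℝ, ContDiff ℝ ∞ χ ∧
      eLpNorm (fun x => χ x - max (u x - k) 0) 2 (volume.restrict Ω) < ε ∧
      eLpNorm (fun x => gradient χ x - (if 0 < u x - k then (1 : ℝ) else 0) • G x) 2
        (volume.restrict Ω) < ε ∧
      eLpNorm (fun x => χ x - 0) 2 (surfaceMeasure Ω) < ε := by
    intro ε hε
    have hε2 : 0 < ε / 2 := ENNReal.half_pos hε.ne'
    obtain ⟨N, hN, hN1, hN2⟩ := ((eventually_gt_atTop 0).and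
      (((tendsto_smoothPos_sub h k).1.eventually_lt_const hε2).and
        ((tendsto_smoothPos_sub h k).2.eventually_lt_const hε2))).exists
    have hT := tendsto_smoothPos_comp h (fun n => hφ₀ (ns n)) k hN
      (hu₀.comp hns.tendsto_atTop) hae (hG₀.comp hns.tendsto_atTop)
    obtain ⟨n, hn1, hn2, hn3⟩ := ((hT.1.eventually_lt_const hε2).and
      ((hT.2.eventually_lt_const hε2).and
        ((hg₀.comp hns.tendsto_atTop).eventually_lt_const hε))).exists
    have hχ : ContDiff ℝ ∞ fun x => smoothPos N (φ₀ (ns n) x - k) :=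
      (contDiff_smoothPos N).comp ((hφ₀ (ns n)).sub contDiff_const)
    refine ⟨_, hχ, ?_, ?_, lt_of_le_of_lt (eLpNorm_mono_ae ?_) hn3⟩
    · exact eLpNorm_two_sub_lt hχ.continuous.aestronglyMeasurable
        ((contDiff_smoothPos N).continuous.comp_aestronglyMeasurable hk.1) hv.1 hn1 hN1
    · exact eLpNorm_two_sub_lt (continuous_gradient hχ).aestronglyMeasurable
        ((((contDiff_smoothPos N).continuous_deriv (by simp)).comp_aestronglyMeasurable
          hk.1).smul h.memLp_grad.1) hV.1 hn2 hN2
    -- On the boundary `0 ≤ smoothPos N (φ - k) ≤ (φ - k)⁺ ≤ |φ - g|` because `g ≤ k`, so the trace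
    -- error is that of `φ`.
    · filter_upwards [hgk] with x hx
      rw [sub_zero, Real.norm_eq_abs, Real.norm_eq_abs, abs_of_nonneg (smoothPos_nonneg _ _)]
      refine (smoothPos_le _ _).trans (max_le ?_ (abs_nonneg _))
      exact (by linarith : φ₀ (ns n) x - k ≤ φ₀ (ns n) x - g x).trans (le_abs_self _)
  choose! χ hχ h1 h2 h3 using key
  -- For `n = 0` the tolerance is `⊤`, which is harmless.
  have hpos : ∀ n : ℕ, 0 < ((n : ℝ≥0∞))⁻¹ := fun n => by simp
  have lim : ∀ {f : ℕ → ℝ≥0∞}, (∀ n : ℕ, f n < (n : ℝ≥0∞)⁻¹) → Tendsto f atTop (𝓝 0) :=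
    fun hf => tendsto_of_tendsto_of_tendsto_of_le_of_le tendsto_const_nhds
      ENNReal.tendsto_inv_nat_nhds_zero (fun _ => zero_le) fun n => (hf n).le
  have l1 := lim fun n => h1 _ (hpos n)
  have l2 := lim fun n => h2 _ (hpos n)
  have l3 := lim fun n => h3 _ (hpos n)
  exact ⟨MemH1.of_tendsto hv hV (fun n => hχ _ (hpos n)) l1 l2, MemLp.zero',
    _, fun n => hχ _ (hpos n), l1, l2, l3⟩

end

/-! ### Lines parallel to the first axis -/

section Lines

variable {n : ℕ}

/-- The point of `ℝ^(n+1)` with first coordinate `t` and remaining coordinates `y`. -/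
def linePoint (y : Fin n → ℝ) (t : ℝ) : E (n + 1) := WithLp.toLp 2 (Fin.cons t y)

/-- The projection of `ℝ^(n+1)` that forgets the first coordinate. -/
def tailProj (x : E (n + 1)) : Fin n → ℝ := fun j => x j.succ

@[simp] theorem linePoint_zero (y : Fin n → ℝ) (t : ℝ) : linePoint y t 0 = t := rfl

@[simp] theorem tailProj_linePoint (y : Fin n → ℝ) (t : ℝ) : tailProj (linePoint y t) = y := rfl

theorem linePoint_tailProj (x : E (n + 1)) : linePoint (tailProj x) (x 0) = x := by
  ext i
  refine Fin.cases rfl (fun j => rfl) i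

theorem linePoint_eq (y : Fin n → ℝ) (t : ℝ) :
    linePoint y t = linePoint y 0 + t • EuclideanSpace.single 0 1 := by
  ext i
  refine Fin.cases ?_ (fun j => ?_) i <;> simp [linePoint]

theorem hasDerivAt_linePoint (y : Fin n → ℝ) (t : ℝ) :
    HasDerivAt (linePoint y) (EuclideanSpace.single 0 1) t := by
  have h : HasDerivAt (fun t : ℝ => linePoint y 0 + t • (EuclideanSpace.single 0 1 : E (n + 1)))
      (EuclideanSpace.single 0 1) t := by
    simpa using ((hasDerivAt_id t).smul_const (EuclideanSpace.single 0 1 : E (n + 1))).const_add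
      (linePoint y 0)
  exact h.congr_of_eventuallyEq (Eventually.of_forall (linePoint_eq y))

theorem continuous_linePoint (y : Fin n → ℝ) : Continuous (linePoint y) :=
  continuous_iff_continuousAt.2 fun t => (hasDerivAt_linePoint y t).continuousAt

theorem lipschitzWith_tailProj : LipschitzWith 1 (tailProj (n := n)) := by
  refine LipschitzWith.of_dist_le_mul fun x y => ?_
  rw [NNReal.coe_one, one_mul, dist_pi_le_iff dist_nonneg]
  intro j
  rw [dist_eq_norm, dist_eq_norm]
  exact PiLp.norm_apply_le (x - y) j.succ

theorem measurePreserving_linePoint :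
    MeasurePreserving (fun p : ℝ × (Fin n → ℝ) => linePoint p.2 p.1) := by
  have h := (PiLp.volume_preserving_toLp (Fin (n + 1))).comp
    (volume_preserving_piFinSuccAbove (fun _ : Fin (n + 1) => ℝ) 0).symm
  convert h using 1
  ext p i
  refine Fin.cases ?_ (fun j => ?_) i <;> simp [linePoint, MeasurableEquiv.piFinSuccAbove]

theorem quasiMeasurePreserving_tailProj :
    Measure.QuasiMeasurePreserving (tailProj (n := n)) volume volume := by
  have h := (volume_preserving_piFinSuccAbove (fun _ : Fin (n + 1) => ℝ) 0).comp
    (PiLp.volume_preserving_ofLp (Fin (n + 1)))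
  exact Measure.quasiMeasurePreserving_snd.comp h.quasiMeasurePreserving

theorem lintegral_eq_lintegral_linePoint {f : E (n + 1) → ℝ≥0∞} (hf : Measurable f) :
    ∫⁻ x, f x = ∫⁻ y, ∫⁻ t, f (linePoint y t) := by
  rw [← measurePreserving_linePoint.lintegral_comp hf]
  exact lintegral_prod_symm _ (hf.comp measurePreserving_linePoint.measurable).aemeasurable

theorem measurable_lintegral_linePoint {f : E (n + 1) → ℝ≥0∞} (hf : Measurable f) :
    Measurable fun y : Fin n → ℝ => ∫⁻ t, f (linePoint y t) :=
  (hf.comp measurePreserving_linePoint.measurable).lintegral_prod_left'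

/-- A line starting at a point of a bounded open set leaves it through the boundary. -/
theorem exists_frontier_enorm_sub_le {Ω : Set (E (n + 1))} (ho : IsOpen Ω)
    (hb : Bornology.IsBounded Ω) {x : E (n + 1)} (hx : x ∈ Ω) :
    ∃ p ∈ frontier Ω, tailProj p = tailProj x ∧ ∀ φ : E (n + 1) → ℝ, ContDiff ℝ ∞ φ →
      ‖φ p - φ x‖ₑ ≤
        ∫⁻ t, Ω.indicator (fun z => ‖gradient φ z‖ₑ) (linePoint (tailProj x) t) := by
  set y := tailProj x
  set s := x 0
  have hxs : linePoint y s = x := linePoint_tailProj x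
  have hc := continuous_linePoint y
  set S : Set ℝ := Set.Ici s ∩ linePoint y ⁻¹' Ωᶜ
  have hS : IsClosed S := isClosed_Ici.inter (ho.isClosed_compl.preimage hc)
  have hSb : BddBelow S := ⟨s, fun t ht => ht.1⟩
  have hSn : S.Nonempty := by
    obtain ⟨R, hR⟩ := hb.exists_norm_le
    refine ⟨max s (R + 1), Set.mem_Ici.2 (le_max_left _ _), fun h => ?_⟩
    have h1 := hR _ h
    have h2 := PiLp.norm_apply_le (linePoint y (max s (R + 1))) 0
    rw [linePoint_zero, Real.norm_eq_abs] at h2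
    linarith [le_max_right s (R + 1), le_abs_self (max s (R + 1))]
  -- The first exit time from `Ω` after `s`; the line stays in `Ω` on `[s, τ)`.
  set τ := sInf S
  have hτ : τ ∈ S := hS.csInf_mem hSn hSb
  have hin : ∀ t ∈ Set.Ico s τ, linePoint y t ∈ Ω := fun t ht => by
    by_contra h
    exact notMem_of_lt_csInf ht.2 hSb ⟨ht.1, h⟩
  have hlt : s < τ := lt_of_le_of_ne hτ.1 fun h => hτ.2 (by rw [← h, hxs]; exact hx)
  refine ⟨linePoint y τ, ?_, tailProj_linePoint y τ, fun φ hφ => ?_⟩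
  · rw [ho.frontier_eq]
    refine ⟨map_mem_closure hc ?_ hin, hτ.2⟩
    rw [closure_Ico hlt.ne]
    exact ⟨hlt.le, le_rfl⟩
  · have hd : ∀ t, HasDerivAt (fun t => φ (linePoint y t)) (gradient φ (linePoint y t) 0) t := by
      intro t
      rw [gradient_apply]
      exact (hφ.differentiable (by simp) _).hasFDerivAt.comp_hasDerivAt t (hasDerivAt_linePoint y t)
    have hcd : Continuous fun t => gradient φ (linePoint y t) 0 :=
      (EuclideanSpace.proj (𝕜 := ℝ) (0 : Fin (n + 1))).continuous.comp
        ((continuous_gradient hφ).comp hc)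
    have hF := intervalIntegral.integral_eq_sub_of_hasDerivAt (fun t _ => hd t)
      (hcd.intervalIntegrable s τ)
    rw [hxs] at hF
    rw [← hF, intervalIntegral.integral_of_le hlt.le]
    refine (enorm_integral_le_lintegral_enorm _).trans ?_
    -- The endpoint `τ` is dropped because the indicator of `Ω` vanishes there.
    rw [← restrict_Ioo_eq_restrict_Ioc]
    refine le_trans ?_ (setLIntegral_le_lintegral (Set.Ioo s τ) _)
    refine setLIntegral_mono' measurableSet_Ioo fun t ht => ?_
    rw [Set.indicator_of_mem (hin t ⟨ht.1.le, ht.2⟩)]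
    exact enorm_le_iff_norm_le.2 (PiLp.norm_apply_le _ _)

/-- The projection is 1-Lipschitz, so it does not increase `n`-dimensional Hausdorff measure, and on
`Fin n → ℝ` with the sup metric that measure is Lebesgue measure. The exceptional boundary set thus
meets only a null set of lines. -/
theorem ae_tailProj_of_ae_surfaceMeasure {Ω : Set (E (n + 1))} {P : E (n + 1) → Prop}
    (h : ∀ᵐ x ∂(surfaceMeasure Ω), P x) :
    ∀ᵐ y : Fin n → ℝ, ∀ p ∈ frontier Ω, tailProj p = y → P p := by
  rw [surfaceMeasure, ae_restrict_iff' isClosed_frontier.measurableSet, ae_iff] at h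
  have h1 := lipschitzWith_tailProj.hausdorffMeasure_image_le (n.cast_nonneg (α := ℝ))
    {a | ¬(a ∈ frontier Ω → P a)}
  have hn : ((n + 1 : ℕ) : ℝ) - 1 = n := by push_cast; ring
  rw [hn] at h
  rw [h, mul_zero, nonpos_iff_eq_zero] at h1
  have h2 : (Measure.hausdorffMeasure (n : ℝ) : Measure (Fin n → ℝ)) = volume := by
    simpa using hausdorffMeasure_pi_real (ι := Fin n)
  rw [h2] at h1
  refine measure_mono_null (fun y hy => ?_) h1
  obtain ⟨p, hp, hpy, hP⟩ : ∃ p ∈ frontier Ω, tailProj p = y ∧ ¬P p := by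
    by_contra! hcon
    exact hy hcon
  exact ⟨p, fun h => hP (h hp), hpy⟩

end Lines

/-- Along a subsequence with summable integrals, the sum of the functions has finite integral, hence
is finite a.e., and so its terms tend to zero. -/
theorem exists_subseq_ae_tendsto_zero_of_lintegral {X : Type*} [MeasurableSpace X]
    {μ : Measure X} {h : ℕ → X → ℝ≥0∞} (hm : ∀ n, Measurable (h n))
    (hh : Tendsto (fun n => ∫⁻ x, h n x ∂μ) atTop (𝓝 0)) :
    ∃ ns : ℕ → ℕ, StrictMono ns ∧ ∀ᵐ x ∂μ, Tendsto (fun n => h (ns n) x) atTop (𝓝 0) := by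
  obtain ⟨ε, hε, hsum⟩ := ENNReal.exists_pos_sum_of_countable' (one_ne_zero (α := ℝ≥0∞)) ℕ
  obtain ⟨ns, hns, hle⟩ := extraction_forall_of_eventually'
    (P := fun k n => ∫⁻ x, h n x ∂μ < ε k)
    (fun k => eventually_atTop.1 (hh.eventually_lt_const (hε k)))
  refine ⟨ns, hns, ?_⟩
  have h1 : ∫⁻ x, ∑' k, h (ns k) x ∂μ ≠ ⊤ := by
    rw [lintegral_tsum fun k => (hm _).aemeasurable]
    exact ((ENNReal.tsum_le_tsum fun k => (hle k).le).trans_lt (hsum.trans ENNReal.one_lt_top)).ne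
  filter_upwards [ae_lt_top (Measurable.tsum fun k => hm _) h1] with x hx
  exact ENNReal.tendsto_atTop_zero_of_tsum_ne_top hx.ne

/-! ### Uniqueness in `H¹_0` -/

/-- A function in `H¹_0(Ω)` with zero gradient vanishes. -/
theorem MemH1g.ae_eq_zero {d : ℕ} (hd : 0 < d) {Ω : Set (E d)} (ho : IsOpen Ω)
    (hb : Bornology.IsBounded Ω) {v : E d → ℝ} {V : E d → E d}
    (h : MemH1g Ω (fun _ => 0) v V) (hV : V =ᵐ[volume.restrict Ω] 0) :
    v =ᵐ[volume.restrict Ω] 0 := by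
  obtain ⟨n, rfl⟩ : ∃ n, d = n + 1 := ⟨d - 1, by omega⟩
  have : IsFiniteMeasure (volume.restrict Ω) :=
    isFiniteMeasure_restrict.2 hb.measure_lt_top.ne
  obtain ⟨h, -, φ, hφ, hv, hG, hS⟩ := h
  have meas : ∀ n, Measurable (Ω.indicator fun z => ‖gradient (φ n) z‖ₑ) := fun n =>
    (continuous_gradient (hφ n)).enorm.measurable.indicator ho.measurableSet
  have hG1 : Tendsto (fun n => ∫⁻ y, ∫⁻ t, Ω.indicator (fun z => ‖gradient (φ n) z‖ₑ)
      (linePoint y t)) atTop (𝓝 0) := by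
    -- As `Ω` has finite measure, Hölder turns `L²` smallness of the gradients into `L¹` smallness,
    -- to which Fubini applies.
    have hG' : Tendsto (fun n => eLpNorm (gradient (φ n)) 2 (volume.restrict Ω) *
        (volume.restrict Ω) Set.univ ^ (1 / (1 : ℝ≥0∞).toReal - 1 / (2 : ℝ≥0∞).toReal))
        atTop (𝓝 0) := by
      have hG2 : Tendsto (fun n => eLpNorm (gradient (φ n)) 2 (volume.restrict Ω)) atTop (𝓝 0) := by
        refine hG.congr fun n => eLpNorm_congr_ae ?_
        filter_upwards [hV] with x hx
        simp [hx]
      have hfin : (volume.restrict Ω) Set.univ ^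
          (1 / (1 : ℝ≥0∞).toReal - 1 / (2 : ℝ≥0∞).toReal) ≠ ⊤ :=
        ENNReal.rpow_ne_top_of_nonneg (by norm_num) (measure_ne_top _ _)
      simpa only [zero_mul] using ENNReal.Tendsto.mul_const hG2 (Or.inr hfin)
    refine tendsto_of_tendsto_of_tendsto_of_le_of_le tendsto_const_nhds hG' (fun _ => zero_le)
      fun n => ?_
    have := eLpNorm_le_eLpNorm_mul_rpow_measure_univ (p := 1) (q := 2) (by norm_num)
      (continuous_gradient (hφ n)).aestronglyMeasurable (μ := volume.restrict Ω)
    rw [eLpNorm_one_eq_lintegral_enorm, ← lintegral_indicator ho.measurableSet,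
      lintegral_eq_lintegral_linePoint (meas n)] at this
    exact this
  obtain ⟨n1, hn1, hae1⟩ := tendsto_ae_subseq_of_tendsto_eLpNorm_two
    (fun n => (hφ n).continuous.aestronglyMeasurable) aestronglyMeasurable_const hS
  obtain ⟨n2, hn2, hae2⟩ := tendsto_ae_subseq_of_tendsto_eLpNorm_two
    (fun n => (hφ (n1 n)).continuous.aestronglyMeasurable) h.memLp.1 (hv.comp hn1.tendsto_atTop)
  obtain ⟨n3, hn3, hae3⟩ := exists_subseq_ae_tendsto_zero_of_lintegral
    (fun n => measurable_lintegral_linePoint (meas (n1 (n2 n))))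
    (hG1.comp (hn1.comp hn2).tendsto_atTop)
  have hproj := quasiMeasurePreserving_tailProj.ae
    (hae3.and (ae_tailProj_of_ae_surfaceMeasure hae1))
  filter_upwards [hae2, ae_restrict_of_ae hproj, ae_restrict_mem ho.measurableSet]
    with x hx2 hx3 hx
  obtain ⟨p, hp, hpx, hle⟩ := exists_frontier_enorm_sub_le ho hb hx
  have t1 := hx2.comp hn3.tendsto_atTop
  have t2 := (hx3.2 p hp hpx).comp (hn2.comp hn3).tendsto_atTop
  -- The values at `p` tend to `0` and those at `x` to `v x`, while their difference tends to `0`;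
  -- hence `v x = 0`.
  have t3 : Tendsto (fun k => ‖φ (n1 (n2 (n3 k))) p - φ (n1 (n2 (n3 k))) x‖ₑ) atTop (𝓝 0) :=
    tendsto_of_tendsto_of_tendsto_of_le_of_le tendsto_const_nhds hx3.1 (fun _ => zero_le)
      fun k => hle _ (hφ _)
  have t4 := tendsto_nhds_unique t3 (t2.sub t1).enorm
  simpa using t4.symm

/-! ### Weak maximum principle and the two barriers -/

section

variable {d : ℕ}

theorem integrable_mulVec_dotProduct {X : Type*} [MeasurableSpace X] {μ : Measure X}
    (A : Matrix (Fin d) (Fin d) ℝ) {G V : X → E d} (hG : MemLp G 2 μ) (hV : MemLp V 2 μ) :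
    Integrable (fun x => (A *ᵥ ⇑(G x)) ⬝ᵥ ⇑(V x)) μ := by
  have hc : ∀ {W : X → E d} (i : Fin d), MemLp W 2 μ → MemLp (fun x => W x i) 2 μ := fun i h =>
    h.continuousLinearMap_comp (EuclideanSpace.proj (𝕜 := ℝ) i)
  simp only [dotProduct, Matrix.mulVec]
  refine integrable_finsetSum _ fun i _ => ?_
  exact (memLp_finsetSum _ fun j _ => (hc j hG).const_mul (A i j)).integrable_mul (hc i hV)

/-- `D` is constant on each of the two open pieces and `Γ` is null, so measurability of `D` is
automatic. Integrability is what allows a zero integral to force the integrand to vanish a.e. -/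
theorem integrable_diffusion {Ω Ω₁ Ω₂ Γ : Set (E d)}
    (hΓ : IsInterfaceDecomposition Ω Ω₁ Ω₂ Γ) {D : E d → Matrix (Fin d) (Fin d) ℝ} {m M : ℝ}
    (hD : IsDiffusionCoefficient Ω Ω₁ Ω₂ D m M) {G V : E d → E d}
    (hG : MemLp G 2 (volume.restrict Ω)) (hV : MemLp V 2 (volume.restrict Ω)) :
    Integrable (fun x => (D x *ᵥ ⇑(G x)) ⬝ᵥ ⇑(V x)) (volume.restrict Ω) := by
  have piece : ∀ {s : Set (E d)}, IsOpen s → s ⊆ Ω →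
      (∃ A : Matrix (Fin d) (Fin d) ℝ, ∀ x ∈ s, D x = A) →
      IntegrableOn (fun x => (D x *ᵥ ⇑(G x)) ⬝ᵥ ⇑(V x)) s := by
    rintro s hs hsΩ ⟨A, hA⟩
    have := integrable_mulVec_dotProduct A (hG.mono_measure (Measure.restrict_mono_set _ hsΩ))
      (hV.mono_measure (Measure.restrict_mono_set _ hsΩ))
    refine IntegrableOn.congr_fun this (fun x hx => ?_) hs.measurableSet
    simp only [hA x hx]
  have h1 := piece hΓ.isOpen_left (by rw [hΓ.eq_union]; exact fun x hx => .inl (.inl hx))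
    hD.const_left
  have h2 := piece hΓ.isOpen_right (by rw [hΓ.eq_union]; exact fun x hx => .inr hx)
    hD.const_right
  have h3 : IntegrableOn (fun x => (D x *ᵥ ⇑(G x)) ⬝ᵥ ⇑(V x)) Γ := by
    rw [IntegrableOn, Measure.restrict_eq_zero.2 hΓ.null]
    exact integrable_zero_measure
  have := (h1.union h3).union h2
  rwa [← hΓ.eq_union] at this

/-- The sign condition holds simultaneously for all arguments above the barrier. -/
theorem ae_forall_nonneg_of_lt {X : Type*} [MeasurableSpace X] {μ : Measure X} {b : X → ℝ → ℝ}
    {β : ℝ} (hc : ∀ᵐ x ∂μ, Continuous (b x)) (hb : ∀ ξ, β ≤ ξ → ∀ᵐ x ∂μ, 0 ≤ b x ξ) :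
    ∀ᵐ x ∂μ, ∀ ξ, β < ξ → 0 ≤ b x ξ := by
  have h : ∀ᵐ x ∂μ, ∀ q : ℚ, β ≤ (q : ℝ) → 0 ≤ b x q :=
    ae_all_iff.2 fun q => by
      by_cases hq : β ≤ (q : ℝ)
      · filter_upwards [hb q hq] with x hx _ using hx
      · exact Eventually.of_forall fun x h => absurd h hq
  filter_upwards [h, hc] with x hx hcx ξ hξ
  by_contra! hneg
  -- Continuity and the strict inequality `β < ξ` make the set of violations above `β` open, so it
  -- would contain a rational.
  obtain ⟨q, h1, h2⟩ := Rat.isDenseEmbedding_coe_real.dense.exists_mem_open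
    ((isOpen_lt hcx continuous_const).inter (isOpen_lt continuous_const continuous_id))
    ⟨ξ, hneg, hξ⟩
  exact absurd (hx q (le_of_lt h2)) (not_le.2 h1)

/-- Weak maximum principle: a constant above the barrier and the boundary data bounds a weak
solution from above. -/
theorem IsWeakSolution.le_of_boundary_le (hd : 0 < d) {Ω Ω₁ Ω₂ Γ : Set (E d)} (ho : IsOpen Ω)
    (hbd : Bornology.IsBounded Ω) (hΓ : IsInterfaceDecomposition Ω Ω₁ Ω₂ Γ)
    {D : E d → Matrix (Fin d) (Fin d) ℝ} {m M : ℝ} (hD : IsDiffusionCoefficient Ω Ω₁ Ω₂ D m M)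
    {b : E d → ℝ → ℝ} (hc : ∀ᵐ x ∂(volume.restrict Ω), Continuous (b x)) {k : ℝ}
    (hb : ∀ ξ, k ≤ ξ → ∀ᵐ x ∂(volume.restrict Ω), 0 ≤ b x ξ) {g u : E d → ℝ}
    (hu : IsWeakSolution Ω D b g u) (hg : ∀ᵐ x ∂(surfaceMeasure Ω), g x ≤ k) :
    ∀ᵐ x ∂(volume.restrict Ω), u x ≤ k := by
  have : IsFiniteMeasure (volume.restrict Ω) :=
    isFiniteMeasure_restrict.2 hbd.measure_lt_top.ne
  obtain ⟨G, hG, hweak⟩ := hu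
  have hv := hG.posPart_sub hg
  have hint := integrable_diffusion hΓ hD hG.1.memLp_grad hv.1.memLp_grad
  obtain ⟨-, heq⟩ := hweak _ _ hv
  -- The truncated gradient is either `G x` or `0`, so ellipticity applies to the mixed product.
  have hlow : ∀ x ∈ Ω, m * ‖(if 0 < u x - k then (1 : ℝ) else 0) • G x‖ ^ 2 ≤
      (D x *ᵥ ⇑(G x)) ⬝ᵥ ⇑((if 0 < u x - k then (1 : ℝ) else 0) • G x) := fun x hx => by
    split_ifs
    · simpa [dotProduct_comm] using hD.lower x hx (G x)
    · simp
  have hB : 0 ≤ ∫ x in Ω, b x (u x) * max (u x - k) 0 := by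
    refine integral_nonneg_of_ae ?_
    filter_upwards [ae_forall_nonneg_of_lt hc hb] with x hx
    rcases le_or_gt (u x) k with h | h
    · simp [h]
    · exact mul_nonneg (hx _ h) (le_max_right _ _)
  have hA : 0 ≤ᵐ[volume.restrict Ω] fun x =>
      (D x *ᵥ ⇑(G x)) ⬝ᵥ ⇑((if 0 < u x - k then (1 : ℝ) else 0) • G x) := by
    filter_upwards [ae_restrict_mem ho.measurableSet] with x hx
    exact (mul_nonneg hD.pos_lower.le (sq_nonneg _)).trans (hlow x hx)
  -- Two nonnegative integrals with sum zero both vanish.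
  have hA0 := (integral_eq_zero_iff_of_nonneg_ae hA hint).1
    (le_antisymm (by linarith) (integral_nonneg_of_ae hA))
  have hV : (fun x => (if 0 < u x - k then (1 : ℝ) else 0) • G x) =ᵐ[volume.restrict Ω] 0 := by
    filter_upwards [hA0, ae_restrict_mem ho.measurableSet] with x hx hxΩ
    have h1 := hlow x hxΩ
    rw [hx] at h1
    have h2 : ‖(if 0 < u x - k then (1 : ℝ) else 0) • G x‖ ^ 2 ≤ 0 :=
      nonpos_of_mul_nonpos_right h1 hD.pos_lower
    exact norm_eq_zero.1 (pow_eq_zero_iff two_ne_zero |>.1 (le_antisymm h2 (sq_nonneg _)))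
  filter_upwards [hv.ae_eq_zero hd ho hbd hV] with x hx
  have : u x - k ≤ 0 := (le_max_left _ _).trans_eq hx
  linarith

theorem gradient_neg (φ : E d → ℝ) (x : E d) : gradient (fun y => -φ y) x = -gradient φ x := by
  ext i
  simp [gradient_apply, fderiv_fun_neg]

theorem MemH1g.neg {Ω : Set (E d)} {g u : E d → ℝ} {G : E d → E d} (h : MemH1g Ω g u G) :
    MemH1g Ω (fun x => -g x) (fun x => -u x) (fun x => -G x) := by
  obtain ⟨⟨h1, h2, h3⟩, hg, φ, hφ, l1, l2, l3⟩ := h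
  have hs : ∀ {F : Type} [NormedAddCommGroup F] {μ : Measure (E d)} (a c : E d → F),
      eLpNorm (fun x => -a x - -c x) 2 μ = eLpNorm (fun x => a x - c x) 2 μ := fun a c =>
    eLpNorm_congr_norm_ae (Eventually.of_forall fun x => by rw [neg_sub_neg, norm_sub_rev])
  refine ⟨⟨h1.neg, h2.neg, fun η hη hc hs i => ?_⟩, hg.neg, fun n x => -φ n x,
    fun n => (hφ n).neg, ?_, ?_, ?_⟩
  · simp only [PiLp.neg_apply, neg_mul, integral_neg]
    rw [h3 η hη hc hs i]
  · simpa only [hs] using l1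
  · simpa only [gradient_neg, hs] using l2
  · simpa only [hs] using l3

/-- This reflection exchanges the two barriers, so the lower bound follows from the upper one. -/
theorem IsWeakSolution.neg {Ω : Set (E d)} {D : E d → Matrix (Fin d) (Fin d) ℝ}
    {b : E d → ℝ → ℝ} {g u : E d → ℝ} (h : IsWeakSolution Ω D b g u) :
    IsWeakSolution Ω D (fun x ξ => -b x (-ξ)) (fun x => -g x) (fun x => -u x) := by
  obtain ⟨G, hG, hw⟩ := h
  refine ⟨_, hG.neg, fun v V hv => ?_⟩
  obtain ⟨h1, h2⟩ := hw v V hv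
  simp only [neg_neg, neg_mul]
  refine ⟨h1.neg, ?_⟩
  have : ∀ x, (D x *ᵥ ⇑(-G x)) ⬝ᵥ ⇑(V x) = -((D x *ᵥ ⇑(G x)) ⬝ᵥ ⇑(V x)) := fun x => by
    rw [WithLp.ofLp_neg, Matrix.mulVec_neg, neg_dotProduct]
  simp only [this, integral_neg]
  linarith

theorem ae_coe_le_upperBarrier (hd : 0 < d) {Ω Ω₁ Ω₂ Γ : Set (E d)} (ho : IsOpen Ω)
    (hbd : Bornology.IsBounded Ω) (hΓ : IsInterfaceDecomposition Ω Ω₁ Ω₂ Γ)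
    {D : E d → Matrix (Fin d) (Fin d) ℝ} {m M : ℝ} (hD : IsDiffusionCoefficient Ω Ω₁ Ω₂ D m M)
    {b : E d → ℝ → ℝ} (hc : ∀ᵐ x ∂(volume.restrict Ω), Continuous (b x)) {β : ℝ}
    (hb : ∀ ξ, β ≤ ξ → ∀ᵐ x ∂(volume.restrict Ω), 0 ≤ b x ξ) {g u : E d → ℝ}
    (hu : IsWeakSolution Ω D b g u) :
    ∀ᵐ x ∂(volume.restrict Ω), (u x : EReal) ≤ upperBarrier Ω g β := by
  have hβ : (β : EReal) ≤ upperBarrier Ω g β := le_max_left _ _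
  have hS : ∀ᵐ x ∂(surfaceMeasure Ω), (g x : EReal) ≤ upperBarrier Ω g β := by
    filter_upwards [ae_le_essSup (μ := surfaceMeasure Ω) (f := fun x => (g x : EReal))] with x hx
    exact hx.trans (le_max_right _ _)
  -- Only `β ≤ U` and `g ≤ U` matter: `U = ⊥` contradicts the former, `U = ⊤` is void, and a finite
  -- `U` serves as truncation level.
  generalize upperBarrier Ω g β = U at hβ hS
  induction U with
  | bot => simp at hβ
  | top => simp
  | coe k =>
    have h := hu.le_of_boundary_le hd ho hbd hΓ hD hc
      (fun ξ hξ => hb ξ ((EReal.coe_le_coe_iff.1 hβ).trans hξ))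
      (by simpa only [EReal.coe_le_coe_iff] using hS)
    simpa only [EReal.coe_le_coe_iff] using h

theorem ae_lowerBarrier_le_coe (hd : 0 < d) {Ω Ω₁ Ω₂ Γ : Set (E d)} (ho : IsOpen Ω)
    (hbd : Bornology.IsBounded Ω) (hΓ : IsInterfaceDecomposition Ω Ω₁ Ω₂ Γ)
    {D : E d → Matrix (Fin d) (Fin d) ℝ} {m M : ℝ} (hD : IsDiffusionCoefficient Ω Ω₁ Ω₂ D m M)
    {b : E d → ℝ → ℝ} (hc : ∀ᵐ x ∂(volume.restrict Ω), Continuous (b x)) {α : ℝ}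
    (hb : ∀ ξ, ξ ≤ α → ∀ᵐ x ∂(volume.restrict Ω), b x ξ ≤ 0) {g u : E d → ℝ}
    (hu : IsWeakSolution Ω D b g u) :
    ∀ᵐ x ∂(volume.restrict Ω), lowerBarrier Ω g α ≤ (u x : EReal) := by
  have hα : lowerBarrier Ω g α ≤ (α : EReal) := min_le_left _ _
  have hS : ∀ᵐ x ∂(surfaceMeasure Ω), lowerBarrier Ω g α ≤ (g x : EReal) := by
    filter_upwards [ae_essInf_le (μ := surfaceMeasure Ω) (f := fun x => (g x : EReal))] with x hx
    exact (min_le_right _ _).trans hx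
  generalize lowerBarrier Ω g α = U at hα hS
  induction U with
  | bot => simp
  | top => simp at hα
  | coe k =>
    simp only [EReal.coe_le_coe_iff] at hα hS ⊢
    have h := hu.neg.le_of_boundary_le hd ho hbd hΓ hD (k := -k)
      (by filter_upwards [hc] with x hx using (hx.comp continuous_neg).neg)
      (fun ξ hξ => by filter_upwards [hb (-ξ) (by linarith)] with x hx using neg_nonneg.2 hx)
      (by filter_upwards [hS] with x hx using neg_le_neg hx)
    filter_upwards [h] with x hx using neg_le_neg_iff.1 hx

end

end SemilinearInterface

theorem mainTheorem6 (d : ℕ) (hd : 2 ≤ d)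
    (Ω Ω₁ Ω₂ Γ : Set (SemilinearInterface.E d))
    (hΩ : SemilinearInterface.IsLipschitzDomain Ω)
    (hΓ : SemilinearInterface.IsInterfaceDecomposition Ω Ω₁ Ω₂ Γ)
    (D : SemilinearInterface.E d → Matrix (Fin d) (Fin d) ℝ) (m M : ℝ)
    (hD : SemilinearInterface.IsDiffusionCoefficient Ω Ω₁ Ω₂ D m M)
    (b : SemilinearInterface.E d → ℝ → ℝ) (hb : SemilinearInterface.IsCaratheodory Ω b)
    (α β : ℝ) (hαβ : SemilinearInterface.HasBarrierSigns Ω b α β)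
    (g u : SemilinearInterface.E d → ℝ)
    (hu : SemilinearInterface.IsWeakSolution Ω D b g u) :
    ∀ᵐ x ∂(volume.restrict Ω),
      SemilinearInterface.lowerBarrier Ω g α ≤ (u x : EReal) ∧
        (u x : EReal) ≤ SemilinearInterface.upperBarrier Ω g β := by
  have hd' : 0 < d := by omega
  exact (SemilinearInterface.ae_lowerBarrier_le_coe hd' hΩ.isOpen hΩ.isBounded hΓ hD
    hb.continuous hαβ.nonpos hu).and (SemilinearInterface.ae_coe_le_upperBarrier hd' hΩ.isOpen
    hΩ.isBounded hΓ hD hb.continuous hαβ.nonneg hu)
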